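/- All spaces are Tychonoff ($T_{3\frac12}$). A space $Y$ is *pseudocompact* if every continuous $f:Y\to\mathbb R$ is bounded; *Ascoli* if for every compact subset $\mathcal K$ of $C(Y,\mathbb R)$ (with the compact-open topology) the evaluation map $Y\times\mathcal K\to\mathbb R$, $(y,f)\mapsto f(y)$, is continuous; a *$k_{\mathbb R}$-space* if every $f:Y\to\mathbb R$ whose restriction to each compact subset is continuous is continuous. It is *$\omega$-bounded* if every sequence (i.e. its set of terms) has compact closure; *sequentially compact* if every sequence has a convergent subsequence; *totally countably compact* if every sequence has a subsequence with compact closure; *near sequentially compact* if for every sequence $(U_n)$ of nonempty open sets there are points $x_n\in U_n$ such that $(x_n)$ has a convergent subsequence; *countably compact* if every sequence has a cluster point. $w(Y)$ denotes the weight, i.e. the least cardinality of a base. For a set $\Lambda$ let $S_\Lambda\subseteq[0,1]^\Lambda$ be the set of all points $x$ whose support $\{i\in\Lambda: x_i\ne 0\}$ is countable. (A) Let $\Lambda$ be a set with $|\Lambda|>\aleph_1$, let $X\subseteq[\tfrac12,1]^\Lambda$, and let $Y=S_\Lambda\cup X$ be considered as a subspace of $[0,1]^\Lambda$. Then (i)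 $Y$ is a pseudocompact Ascoli space; (ii) if $K\subseteq Y$ is compact, then $K\cap S_\Lambda$ and $K\cap X$ are compact; (iii) if $X\neq\emptyset$, then $Y$ is not a $k_{\mathbb R}$-space; (iv) $X$ is closed in $Y$. (B) For every Tychonoff space $X$ there are a Tychonoff pseudocompact Ascoli space $Y$ and an embedding $e:X\to Y$ with closed image such that (i) $Y$ is not a $k_{\mathbb R}$-space; (ii) $w(Y)=\max\{w(X),\aleph_2\}$; (iii) if $X$ is $\omega$-bounded (respectively sequentially compact, totally countably compact, near sequentially compact, countably compact), then so is $Y$. Moreover, if $X\ne\emptyset$, then $Y$ and $e$ can be chosen with the following additional property: there are a set $\Lambda$ with $|\Lambda|=\max\{w(X),\aleph_2\}$, an embedding $T:X\to[0,1]^\Lambda$ with $T(X)\subseteq[\tfrac12,1]^\Lambda$, and a homeomorphism $h$ of $Y$ onto the subspace $S_\Lambda\cup T(X)$ of $[0,1]^\Lambda$ such that $h\circ e=T$. -/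

import Mathlib

open Set Filter Topology Cardinal

universe u v

noncomputable section

/-- The weight `w(X)`: the least cardinality of a base of the topology. -/
def topWeight (X : Type u) [TopologicalSpace X] : Cardinal.{u} :=
  sInf {κ | ∃ B : Set (Set X), TopologicalSpace.IsTopologicalBasis B ∧ #B = κ}

/-- Every continuous real-valued function is bounded. -/
def IsPseudocompactSpace (X : Type u) [TopologicalSpace X] : Prop :=
  ∀ f : C(X, ℝ), ∃ M : ℝ, ∀ x, |f x| ≤ M

/-- Every compact subset `K` of `C(X, ℝ)` with the compact-open topology (the topology which
`C(X, ℝ)` carries in Mathlib) is evenly continuous: the evaluation `X × K → ℝ` is (jointly)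
continuous. Being Tychonoff is always stated separately. -/
def IsAscoliSpace (X : Type u) [TopologicalSpace X] : Prop :=
  ∀ K : Set C(X, ℝ), IsCompact K → Continuous fun p : X × K => (p.2 : C(X, ℝ)) p.1

/-- `k_ℝ`-spaces: every real function whose restriction to each compact set is continuous is
continuous. -/
def IsKRSpace (X : Type u) [TopologicalSpace X] : Prop :=
  ∀ f : X → ℝ, (∀ K : Set X, IsCompact K → ContinuousOn f K) → Continuous f

/-- `ω`-bounded spaces: every sequence has compact closure. -/
def IsOmegaBounded (X : Type u) [TopologicalSpace X] : Prop :=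
  ∀ x : ℕ → X, IsCompact (closure (range x))

/-- Every sequence has a subsequence with compact closure. -/
def IsTotallyCountablyCompact (X : Type u) [TopologicalSpace X] : Prop :=
  ∀ x : ℕ → X, ∃ φ : ℕ → ℕ, StrictMono φ ∧ IsCompact (closure (range (x ∘ φ)))

/-- For every sequence of nonempty open sets `U n` there are points `x n ∈ U n` such that the
sequence `x` has a convergent subsequence. -/
def IsNearSequentiallyCompact (X : Type u) [TopologicalSpace X] : Prop :=
  ∀ U : ℕ → Set X, (∀ n, IsOpen (U n) ∧ (U n).Nonempty) →
    ∃ x : ℕ → X, (∀ n, x n ∈ U n) ∧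
      ∃ (a : X) (φ : ℕ → ℕ), StrictMono φ ∧ Tendsto (x ∘ φ) atTop (𝓝 a)

/-- The `Σ`-product in the Tychonoff cube `[0,1]^Λ`: the points with countable support. -/
def sigmaCube (Λ : Type u) : Set (Λ → unitInterval) :=
  {x | {i | x i ≠ 0}.Countable}

/-- The cube `[1/2,1]^Λ` as a subset of `[0,1]^Λ`. -/
def upperCube (Λ : Type u) : Set (Λ → unitInterval) :=
  {x | ∀ i, (1 / 2 : ℝ) ≤ (x i : ℝ)}

end

/-! The Σ-product `S` is dense in `Y`, and each countable subset of `S` lies in a compact subset of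
`S`, namely the points supported in a fixed countable set. This alone makes `Y` pseudocompact and
Ascoli: countably many witnesses of a failure can be moved into `S` and then enclosed in one compact
set.

The bound `ℵ_ 1 < #Λ` enters only through `isClosed_inter_sigmaCube`: a compact `K ⊆ Y` meets `S` in
a closed set. Since `K ∩ X` is closed too, the indicator of `S` is continuous on every compact set.
By density it is discontinuous as soon as `X` is nonempty, so `Y` is not a `k_ℝ`-space.

For the embedding theorem, Tychonoff's theorem puts `X` into the upper cube. `Y` is then the union
of `S`, which is sequentially compact, and a closed copy of `X`, so the compactness properties pass
from `X` to `Y`. -/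

open TopologicalSpace

/-! ### Pseudocompactness and the Ascoli property from a dense subset -/

section CompactlyCovered

variable {Y : Type u} [TopologicalSpace Y] {S : Set Y}

theorem isPseudocompactSpace_of_dense (hS : Dense S)
    (hc : ∀ C ⊆ S, C.Countable → ∃ L, IsCompact L ∧ C ⊆ L) : IsPseudocompactSpace Y := by
  intro f
  by_contra! h
  have key : ∀ n : ℕ, ∃ s ∈ S, (n : ℝ) < |f s| := by
    intro n
    obtain ⟨x, hx⟩ := h n
    obtain ⟨s, hs, hsS⟩ := hS.inter_open_nonempty {y | (n : ℝ) < |f y|}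
      (isOpen_lt continuous_const (by fun_prop)) ⟨x, hx⟩
    exact ⟨s, hsS, hs⟩
  choose s hsS hs using key
  obtain ⟨L, hL, hsL⟩ := hc (range s) (range_subset_iff.2 hsS) (countable_range s)
  obtain ⟨M, hM⟩ := hL.exists_bound_of_continuousOn f.continuous.continuousOn
  obtain ⟨n, hn⟩ := exists_nat_gt M
  have := hM _ (hsL (mem_range_self n))
  rw [Real.norm_eq_abs] at this
  linarith [hs n]

/-- Compact sets of functions are totally bounded in the uniform distance if the sequences of a
dense set lie in compact sets. -/
theorem exists_finset_forall_abs_sub_le (hS : Dense S)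
    (hc : ∀ C ⊆ S, C.Countable → ∃ L, IsCompact L ∧ C ⊆ L) {K : Set C(Y, ℝ)} (hK : IsCompact K)
    {ε : ℝ} (hε : 0 < ε) :
    ∃ F : Finset C(Y, ℝ), ∀ f ∈ K, ∃ g ∈ F, ∀ y, |g y - f y| ≤ ε := by
  by_contra! h
  obtain ⟨f, hfK, hf⟩ := exists_seq_of_forall_finset_exists (· ∈ K)
    (fun g f : C(Y, ℝ) => ∃ y, ε < |g y - f y|) fun F _ => h F
  have key : ∀ p : ℕ × ℕ, p.1 < p.2 → ∃ s ∈ S, ε < |f p.1 s - f p.2 s| := by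
    intro p hp
    obtain ⟨y, hy⟩ := hf _ _ hp
    obtain ⟨s, hs, hsS⟩ := hS.inter_open_nonempty {y | ε < |f p.1 y - f p.2 y|}
      (isOpen_lt continuous_const (by fun_prop)) ⟨y, hy⟩
    exact ⟨s, hsS, hs⟩
  choose s hsS hs using key
  obtain ⟨L, hL, hsL⟩ := hc (range fun p : {p : ℕ × ℕ // p.1 < p.2} => s p.1 p.2)
    (range_subset_iff.2 fun p => hsS _ _) (countable_range _)
  -- Two terms that are `ε / 2`-close on `L` to a cluster point are less than `ε` apart at their own
  -- witness, which lies in `L`.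
  obtain ⟨g, -, hg⟩ := hK.exists_mapClusterPt (u := f) (f := atTop)
    (tendsto_principal.2 (Eventually.of_forall hfK))
  have hnhds : {k : C(Y, ℝ) | ∀ x ∈ L, |g x - k x| < ε / 2} ∈ 𝓝 g := by
    have := (ContinuousMap.tendsto_iff_forall_isCompact_tendstoUniformlyOn
      (p := 𝓝 g) (F := id) (f := g)).1 tendsto_id L hL
    exact Metric.tendstoUniformlyOn_iff.1 this (ε / 2) (half_pos hε)
  have hfreq : ∃ᶠ n in atTop, ∀ x ∈ L, |g x - f n x| < ε / 2 := hg.frequently hnhds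
  obtain ⟨m, -, hm⟩ := frequently_atTop.1 hfreq 0
  obtain ⟨n, hmn, hn⟩ := frequently_atTop.1 hfreq (m + 1)
  have hlt : (m, n).1 < (m, n).2 := hmn
  have hx := hsL (mem_range_self (⟨(m, n), hlt⟩ : {p : ℕ × ℕ // p.1 < p.2}))
  have h1 := abs_lt.1 (hm _ hx)
  have h2 := abs_lt.1 (hn _ hx)
  have h3 := hs (m, n) hlt
  refine absurd h3 (not_lt.2 (abs_le.2 ⟨?_, ?_⟩)) <;> linarith

theorem isAscoliSpace_of_dense (hS : Dense S)
    (hc : ∀ C ⊆ S, C.Countable → ∃ L, IsCompact L ∧ C ⊆ L) : IsAscoliSpace Y := by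
  intro K hK
  rw [continuous_iff_continuousAt]
  rintro ⟨y₀, f₀⟩
  refine Metric.tendsto_nhds.2 fun ε hε => ?_
  -- Four errors of size at most `ε / 5` add up on the path `f y`, `g y`, `g y₀`, `f y₀`, `f₀ y₀`.
  obtain ⟨F, hF⟩ := exists_finset_forall_abs_sub_le hS hc hK (ε := ε / 5) (by positivity)
  have h1 : ∀ᶠ y in 𝓝 y₀, ∀ g ∈ F, |g y - g y₀| < ε / 5 :=
    (Finset.eventually_all F).2 fun g _ =>
      Metric.tendsto_nhds.1 (g.continuous.tendsto y₀) (ε / 5) (by positivity)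
  have h2 : ∀ᶠ f : K in 𝓝 f₀, |(f : C(Y, ℝ)) y₀ - (f₀ : C(Y, ℝ)) y₀| < ε / 5 := by
    have : Continuous fun f : K => (f : C(Y, ℝ)) y₀ :=
      (continuous_eval_const y₀).comp continuous_subtype_val
    exact Metric.tendsto_nhds.1 (this.tendsto f₀) (ε / 5) (by positivity)
  rw [nhds_prod_eq]
  filter_upwards [h1.prod_mk h2] with p hp
  obtain ⟨g, hgF, hg⟩ := hF _ p.2.2
  have a1 := abs_le.1 (hg p.1)
  have a2 := abs_le.1 (hg y₀)
  have a3 := abs_lt.1 (hp.1 g hgF)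
  have a4 := abs_lt.1 hp.2
  rw [Real.dist_eq, abs_lt]
  constructor <;> linarith

end CompactlyCovered

theorem exists_strictMono_forall_mem_or {Y : Type u} (S : Set Y) (y : ℕ → Y) :
    ∃ φ : ℕ → ℕ, StrictMono φ ∧ ((∀ n, y (φ n) ∈ S) ∨ ∀ n, y (φ n) ∉ S) := by
  by_cases h : ∃ᶠ n in atTop, y n ∈ S
  · obtain ⟨φ, hφ, h⟩ := extraction_of_frequently_atTop h
    exact ⟨φ, hφ, Or.inl h⟩
  · obtain ⟨φ, hφ, h⟩ := extraction_of_eventually_atTop (not_frequently.1 h)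
    exact ⟨φ, hφ, Or.inr h⟩

/-! ### Weight and Tychonoff's embedding -/

section Weight

theorem exists_isTopologicalBasis_mk_eq_topWeight (X : Type u) [TopologicalSpace X] :
    ∃ B : Set (Set X), IsTopologicalBasis B ∧ #B = topWeight X :=
  csInf_mem (s := {κ | ∃ B : Set (Set X), IsTopologicalBasis B ∧ #B = κ})
    ⟨_, _, isTopologicalBasis_opens, rfl⟩

theorem topWeight_le {X : Type u} [TopologicalSpace X] {B : Set (Set X)}
    (hB : IsTopologicalBasis B) : topWeight X ≤ #B :=
  csInf_le' ⟨B, hB, rfl⟩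

theorem topWeight_le_one (X : Type u) [TopologicalSpace X] [Subsingleton X] :
    topWeight X ≤ 1 := by
  have hB : IsTopologicalBasis {(univ : Set X)} := by
    refine isTopologicalBasis_of_isOpen_of_nhds (by simp) fun a u ha _ => ⟨univ, rfl, trivial, ?_⟩
    exact fun b _ => Subsingleton.elim a b ▸ ha
  exact (topWeight_le hB).trans (by simp)

theorem Topology.IsInducing.topWeight_le {X Y : Type u} [TopologicalSpace X] [TopologicalSpace Y]
    {f : X → Y} (hf : IsInducing f) : topWeight X ≤ topWeight Y := by
  obtain ⟨B, hB, hBw⟩ := exists_isTopologicalBasis_mk_eq_topWeight Y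
  exact (_root_.topWeight_le (hB.isInducing hf)).trans (mk_image_le.trans hBw.le)

theorem topWeight_le_of_eq_generateFrom {X : Type u} [t : TopologicalSpace X] {s : Set (Set X)}
    (hs : t = generateFrom s) {κ : Cardinal.{u}} (hκ : ℵ₀ ≤ κ) (hsκ : #s ≤ κ) :
    topWeight X ≤ κ := by
  refine (topWeight_le (isTopologicalBasis_of_subbasis hs)).trans (mk_image_le.trans ?_)
  have hsub : {f : Set (Set X) | f.Finite ∧ f ⊆ s} ⊆
      range fun F : Finset s => (Subtype.val '' (F : Set s)) := by
    rintro f ⟨hf, hfs⟩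
    have : ((Subtype.val : s → Set X) ⁻¹' f).Finite := hf.preimage Subtype.val_injective.injOn
    refine ⟨this.toFinset, ?_⟩
    simpa [inter_eq_right] using hfs
  refine (mk_le_mk_of_subset hsub).trans (mk_range_le.trans ?_)
  rcases finite_or_infinite s with h | h
  · exact (lt_aleph0_of_finite _).le.trans hκ
  · rwa [mk_finset_of_infinite]

theorem topWeight_cube_le {Λ : Type u} (hΛ : ℵ₀ ≤ #Λ) : topWeight (Λ → unitInterval) ≤ #Λ := by
  have ht : (inferInstance : TopologicalSpace (Λ → unitInterval)) =
      generateFrom (⋃ i, preimage (fun x : Λ → unitInterval => x i) ''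
        countableBasis unitInterval) := by
    rw [generateFrom_iUnion]
    refine iInf_congr fun i => ?_
    rw [← induced_generateFrom_eq, ← (isBasis_countableBasis unitInterval).eq_generateFrom]
  refine topWeight_le_of_eq_generateFrom ht hΛ ((mk_iUnion_le _).trans ?_)
  refine (mul_le_mul_right (ciSup_le' fun i => ?_) _).trans (mul_aleph0_eq hΛ).le
  exact ((countable_countableBasis unitInterval).image _).le_aleph0

/-- A basic set between `e i` and `O i` contains no other `e j`, so different indices need different
basic sets. -/
theorem mk_le_topWeight {Y ι : Type u} [TopologicalSpace Y] (e : ι → Y) (O : ι → Set Y)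
    (hO : ∀ i, IsOpen (O i)) (he : ∀ i, e i ∈ O i) (hne : ∀ i j, e j ∈ O i → j = i) :
    #ι ≤ topWeight Y := by
  obtain ⟨B, hB, hBw⟩ := exists_isTopologicalBasis_mk_eq_topWeight Y
  rw [← hBw]
  choose b hb heb hbO using fun i => hB.exists_subset_of_mem_open (he i) (hO i)
  refine mk_le_of_injective (f := fun i => (⟨b i, hb i⟩ : B)) fun i j hij => ?_
  have hij' : b i = b j := congrArg Subtype.val hij
  exact (hne i j (hbO i (hij' ▸ heb j))).symm

/-- Tychonoff's embedding theorem, with the number of coordinates bounded by the weight. -/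
theorem exists_isEmbedding_upperCube (X : Type u) [TopologicalSpace X] [T35Space X] {Λ : Type u}
    (hΛ : ℵ₀ ≤ #Λ) (hX : topWeight X ≤ #Λ) :
    ∃ T : X → Λ → unitInterval, IsEmbedding T ∧ range T ⊆ upperCube Λ := by
  classical
  obtain ⟨B, hB, hBw⟩ := exists_isTopologicalBasis_mk_eq_topWeight X
  have hcard : #(B × B) ≤ #Λ := by
    rw [← mul_def, hBw]
    exact (mul_le_mul' hX hX).trans (mul_eq_self hΛ).le
  obtain ⟨j⟩ := hcard
  let half : unitInterval := ⟨1 / 2, by norm_num, by norm_num⟩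
  have hhalf : half < 1 := Subtype.mk_lt_mk.2 (by norm_num)
  let P : B × B → (X → unitInterval) → Prop := fun p f =>
    (∀ x ∈ (p.1 : Set X), f x = half) ∧ ∀ x ∉ (p.2 : Set X), f x = 1
  have hF : ∀ p, ∃ f : X → unitInterval, Continuous f ∧ (∀ x, half ≤ f x) ∧
      ((∃ g, Continuous g ∧ (∀ x, half ≤ g x) ∧ P p g) → P p f) := by
    intro p
    by_cases h : ∃ g, Continuous g ∧ (∀ x, half ≤ g x) ∧ P p g
    · obtain ⟨g, hg, hg', hP⟩ := h
      exact ⟨g, hg, hg', fun _ => hP⟩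
    · exact ⟨fun _ => 1, continuous_const, fun _ => hhalf.le, fun h' => absurd h' h⟩
  choose F hFc hFh hFP using hF
  let G : Λ → X → unitInterval := Function.extend j F fun _ _ => 1
  have hGj : ∀ p, G (j p) = F p := j.injective.extend_apply F _
  have hG : ∀ i, Continuous (G i) ∧ ∀ x, half ≤ G i x := by
    intro i
    by_cases h : ∃ p, j p = i
    · obtain ⟨p, rfl⟩ := h
      rw [hGj]
      exact ⟨hFc p, hFh p⟩
    · have : G i = fun _ => 1 := Function.extend_apply' _ _ _ h
      rw [this]
      exact ⟨continuous_const, fun _ => hhalf.le⟩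
  have hTc : Continuous fun x i => G i x := continuous_pi fun i => (hG i).1
  refine ⟨fun x i => G i x, IsInducing.isEmbedding (isInducing_iff_nhds.2 fun x => le_antisymm
    (hTc.tendsto x).le_comap fun W hW => ?_), ?_⟩
  · obtain ⟨V, hV, hxV, hVW⟩ := hB.mem_nhds_iff.1 hW
    obtain ⟨g, hgc, hgx, hg⟩ := CompletelyRegularSpace.completely_regular x Vᶜ
      (hB.isOpen hV).isClosed_compl (by simpa using hxV)
    have hopen : IsOpen {y | g y < half} := isOpen_lt hgc continuous_const
    have hxg : g x < half := by
      rw [hgx]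
      exact Subtype.mk_lt_mk.2 (by norm_num)
    obtain ⟨U, hU, hxU, hUg⟩ := hB.exists_subset_of_mem_open hxg hopen
    have hP : P (⟨U, hU⟩, ⟨V, hV⟩) (F (⟨U, hU⟩, ⟨V, hV⟩)) := by
      -- Truncating at `half` makes the function constant on all of `U`, so the condition on the
      -- pair does not mention the point `x`.
      refine hFP _ ⟨fun y => max half (g y), by fun_prop, fun y => le_max_left _ _, ?_, ?_⟩
      · exact fun y hy => max_eq_left (hUg hy).le
      · intro y hy
        simp only [hg (show y ∈ Vᶜ from hy), Pi.one_apply]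
        exact max_eq_right hhalf.le
    refine mem_comap.2 ⟨{z | z (j (⟨U, hU⟩, ⟨V, hV⟩)) < 1},
      (isOpen_lt (continuous_apply _) continuous_const).mem_nhds ?_, fun y hy => hVW ?_⟩
    · simp only [mem_ofPred_eq, hGj]
      rw [hP.1 x hxU]
      exact hhalf
    · by_contra hyV
      simp only [mem_preimage, mem_ofPred_eq, hGj] at hy
      exact hy.ne (hP.2 y hyV)
  · rintro _ ⟨x, rfl⟩ i
    exact (hG i).2 x

end Weight

/-! ### The Σ-product and the upper cube -/

section Cube

variable {Λ : Type v}

/-- The points of the cube `[0,1]^Λ` with support in `D`. -/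
def supportedCube (D : Set Λ) : Set (Λ → unitInterval) :=
  {x | ∀ i ∉ D, x i = 0}

theorem isClosed_supportedCube (D : Set Λ) : IsClosed (supportedCube D) := by
  simp only [supportedCube, ofPred_forall]
  exact isClosed_iInter fun i => isClosed_iInter fun _ =>
    isClosed_eq (continuous_apply i) continuous_const

theorem supportedCube_subset_sigmaCube {D : Set Λ} (hD : D.Countable) :
    supportedCube D ⊆ sigmaCube Λ := fun _ hx => hD.mono fun i hi => by
  by_contra h
  exact hi (hx i h)

/-- This set is the image of a countable power of `[0,1]`, which is sequentially compact, under
extension by zero. -/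
theorem isSeqCompact_supportedCube {D : Set Λ} (hD : D.Countable) :
    IsSeqCompact (supportedCube D) := by
  classical
  have := hD.to_subtype
  let g : (D → unitInterval) → Λ → unitInterval := fun x i => if h : i ∈ D then x ⟨i, h⟩ else 0
  have hg : Continuous g := by
    refine continuous_pi fun i => ?_
    by_cases h : i ∈ D
    · simpa [g, h] using continuous_apply _
    · simpa [g, h] using continuous_const
  have : supportedCube D = range g := by
    ext x
    constructor
    · intro hx
      refine ⟨fun i => x i, funext fun i => ?_⟩
      by_cases h : i ∈ D
      · simp [g, h]
      · simp [g, h, hx i h]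
    · rintro ⟨y, rfl⟩ i hi
      simp [g, hi]
  rw [this]
  exact IsSeqCompact.range hg.seqContinuous

theorem exists_countable_subset_supportedCube {C : Set (Λ → unitInterval)} (hC : C.Countable)
    (hCS : C ⊆ sigmaCube Λ) : ∃ D : Set Λ, D.Countable ∧ C ⊆ supportedCube D :=
  ⟨⋃ x ∈ C, {i | x i ≠ 0}, hC.biUnion hCS, fun x hx i hi => by
    by_contra h
    exact hi (mem_biUnion hx h)⟩

theorem isSeqCompact_sigmaCube : IsSeqCompact (sigmaCube Λ) := by
  intro x hx
  obtain ⟨D, hD, hxD⟩ :=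
    exists_countable_subset_supportedCube (countable_range x) (range_subset_iff.2 hx)
  obtain ⟨a, ha, φ, hφ, h⟩ := isSeqCompact_supportedCube hD fun n => hxD (mem_range_self n)
  exact ⟨a, supportedCube_subset_sigmaCube hD ha, φ, hφ, h⟩

theorem dense_sigmaCube : Dense (sigmaCube Λ) := by
  classical
  intro x
  refine mem_closure_of_tendsto (f := fun (F : Finset Λ) i => if i ∈ F then x i else 0) (b := atTop)
    (tendsto_pi_nhds.2 fun i => tendsto_const_nhds.congr' ?_) (Eventually.of_forall fun F => ?_)
  · filter_upwards [eventually_ge_atTop {i}] with F hF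
    rw [if_pos (hF (Finset.mem_singleton_self i))]
  · exact F.countable_toSet.mono fun i hi => by
      by_contra h
      exact hi (if_neg h)

theorem isClosed_upperCube : IsClosed (upperCube Λ) := by
  simp only [upperCube, ofPred_forall]
  exact isClosed_iInter fun i =>
    isClosed_le continuous_const (continuous_subtype_val.comp (continuous_apply i))

theorem not_mem_sigmaCube_of_mem_upperCube [Uncountable Λ] {x : Λ → unitInterval}
    (hx : x ∈ upperCube Λ) : x ∉ sigmaCube Λ := by
  intro h
  refine not_countable_univ (h.mono fun i _ => ?_)
  intro h0
  have := hx i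
  rw [h0] at this
  norm_num at this

/-- If the closure of `K ∩ S` contained a point of the upper cube, then some point of `K` would be
bounded away from zero at `ℵ₁` coordinates and zero at some other coordinate. -/
theorem isClosed_inter_sigmaCube (hΛ : ℵ_ 1 < #Λ) {X K : Set (Λ → unitInterval)}
    (hX : X ⊆ upperCube Λ) (hK : IsCompact K) (hKX : K ⊆ sigmaCube Λ ∪ X) :
    IsClosed (K ∩ sigmaCube Λ) := by
  refine isClosed_of_closure_subset fun x hx => ?_
  have hxK : x ∈ K := closure_minimal inter_subset_left hK.isClosed hx
  refine ⟨hxK, (hKX hxK).resolve_right fun hxX => ?_⟩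
  have hxu := hX hxX
  obtain ⟨A, hA⟩ := le_mk_iff_exists_set.1 hΛ.le
  have hAinf : Infinite A := infinite_iff.2 (by rw [hA]; exact aleph0_le_aleph 1)
  have key : ∀ F : Finset A, ∃ z ∈ K ∩ sigmaCube Λ, ∀ a ∈ F, (1 / 4 : ℝ) < z a := by
    intro F
    have hU : IsOpen {z : Λ → unitInterval | ∀ a ∈ F, (1 / 4 : ℝ) < z a} := by
      simp only [ofPred_forall]
      exact isOpen_biInter_finset fun a _ =>
        isOpen_lt continuous_const (continuous_subtype_val.comp (continuous_apply _))
    obtain ⟨z, hz, hzK⟩ := mem_closure_iff.1 hx _ hU fun a _ => by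
      have := hxu a
      linarith
    exact ⟨z, hzK, hz⟩
  choose z hzK hz using key
  -- There are `ℵ₁` finite subsets of `A`, each contributing a countable support, so `D` cannot
  -- exhaust `Λ`.
  let D : Set Λ := ⋃ F, {i | z F i ≠ 0}
  have hD : #D ≤ ℵ_ 1 := by
    refine (mk_iUnion_le _).trans ?_
    rw [mk_finset_of_infinite, hA]
    refine (mul_le_mul_right (ciSup_le' fun F => ?_) _).trans (mul_aleph0_eq (aleph0_le_aleph 1)).le
    exact (hzK F).2.le_aleph0
  obtain ⟨i, hi⟩ : ∃ i, i ∉ D := by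
    by_contra! h
    rw [eq_univ_of_forall h, mk_univ] at hD
    exact hD.not_gt hΛ
  obtain ⟨y, hyK, hy⟩ := hK.inter_iInter_nonempty
    (fun a : A => {y : Λ → unitInterval | (1 / 4 : ℝ) ≤ y a} ∩ supportedCube D)
    (fun a => (isClosed_le continuous_const
      (continuous_subtype_val.comp (continuous_apply _))).inter (isClosed_supportedCube D))
    fun F => ⟨z F, (hzK F).1, mem_iInter₂.2 fun a ha => ⟨(hz F a ha).le, fun i hi => by
      by_contra h
      exact hi (mem_iUnion.2 ⟨F, h⟩)⟩⟩
  rw [mem_iInter] at hy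
  -- The support of `y` contains the uncountable `A`, which excludes `S`; it misses `i`, which
  -- excludes the upper cube.
  rcases hKX hyK with hyS | hyX
  · have hAc : A.Countable := hyS.mono fun a ha => show y a ≠ 0 from fun h0 => by
      have := (hy ⟨a, ha⟩).1
      simp only [mem_ofPred_eq, h0] at this
      norm_num at this
    have := hAc.le_aleph0
    rw [hA] at this
    exact this.not_gt aleph0_lt_aleph_one
  · have h1 := hX hyX i
    rw [(hy (Classical.arbitrary A)).2 i hi] at h1
    norm_num at h1

theorem uncountable_of_aleph_one_lt (hΛ : ℵ_ 1 < #Λ) : Uncountable Λ :=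
  aleph0_lt_mk_iff.1 (aleph0_lt_aleph_one.trans hΛ)

variable {X : Set (Λ → unitInterval)}

/-- `X` itself need not be closed in the cube; inside `S ∪ X` it is cut out by the closed upper
cube. -/
theorem inter_eq_inter_upperCube [Uncountable Λ] (hX : X ⊆ upperCube Λ) {K : Set (Λ → unitInterval)}
    (hKX : K ⊆ sigmaCube Λ ∪ X) : K ∩ X = K ∩ upperCube Λ :=
  Subset.antisymm (inter_subset_inter_right K hX) fun _ hx =>
    ⟨hx.1, (hKX hx.1).resolve_left (not_mem_sigmaCube_of_mem_upperCube hx.2)⟩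

theorem isClosed_setOf_coe_mem [Uncountable Λ] (hX : X ⊆ upperCube Λ) :
    IsClosed {y : ↥(sigmaCube Λ ∪ X) | (y : Λ → unitInterval) ∈ X} := by
  have : {y : ↥(sigmaCube Λ ∪ X) | (y : Λ → unitInterval) ∈ X} = Subtype.val ⁻¹' upperCube Λ := by
    ext y
    exact ⟨fun h => hX h, fun h => y.2.resolve_left (not_mem_sigmaCube_of_mem_upperCube h)⟩
  rw [this]
  exact isClosed_upperCube.preimage continuous_subtype_val

theorem dense_setOf_coe_mem_sigmaCube :
    Dense {y : ↥(sigmaCube Λ ∪ X) | (y : Λ → unitInterval) ∈ sigmaCube Λ} := by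
  rw [Subtype.dense_iff]
  intro x _
  have : (Subtype.val '' {y : ↥(sigmaCube Λ ∪ X) | (y : Λ → unitInterval) ∈ sigmaCube Λ}) =
      sigmaCube Λ := by
    ext y
    simp +contextual
  rw [this]
  exact dense_sigmaCube x

theorem exists_isCompact_of_countable_subset {C : Set ↥(sigmaCube Λ ∪ X)}
    (hCS : C ⊆ {y | (y : Λ → unitInterval) ∈ sigmaCube Λ}) (hC : C.Countable) :
    ∃ L, IsCompact L ∧ C ⊆ L := by
  obtain ⟨D, hD, hCD⟩ := exists_countable_subset_supportedCube (hC.image Subtype.val)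
    (image_subset_iff.2 hCS)
  refine ⟨Subtype.val ⁻¹' supportedCube D, ?_, image_subset_iff.1 hCD⟩
  rw [Subtype.isCompact_iff, Subtype.image_preimage_coe, inter_eq_right.2
    ((supportedCube_subset_sigmaCube hD).trans subset_union_left)]
  exact (isClosed_supportedCube D).isCompact

theorem isCompact_closure_of_countable_subset {C : Set ↥(sigmaCube Λ ∪ X)}
    (hCS : C ⊆ {y | (y : Λ → unitInterval) ∈ sigmaCube Λ}) (hC : C.Countable) :
    IsCompact (closure C) := by
  obtain ⟨L, hL, hCL⟩ := exists_isCompact_of_countable_subset hCS hC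
  exact hL.closure_of_subset hCL

theorem isSeqCompact_setOf_coe_mem_sigmaCube :
    IsSeqCompact {y : ↥(sigmaCube Λ ∪ X) | (y : Λ → unitInterval) ∈ sigmaCube Λ} := by
  intro y hy
  obtain ⟨a, ha, φ, hφ, h⟩ := isSeqCompact_sigmaCube hy
  exact ⟨⟨a, Or.inl ha⟩, ha, φ, hφ, tendsto_subtype_rng.2 h⟩

theorem not_isKRSpace_sigmaCube_union (hΛ : ℵ_ 1 < #Λ) (hX : X ⊆ upperCube Λ) (hne : X.Nonempty) :
    ¬ IsKRSpace ↥(sigmaCube Λ ∪ X) := by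
  classical
  have := uncountable_of_aleph_one_lt hΛ
  intro h
  let S : Set ↥(sigmaCube Λ ∪ X) := {y | (y : Λ → unitInterval) ∈ sigmaCube Λ}
  have hf : Continuous (S.indicator fun _ => (1 : ℝ)) := by
    refine h _ fun K hK => ?_
    have hK' : IsCompact ((Subtype.val : ↥(sigmaCube Λ ∪ X) → _) '' K) :=
      hK.image continuous_subtype_val
    have hsub : (Subtype.val : ↥(sigmaCube Λ ∪ X) → _) '' K ⊆ sigmaCube Λ ∪ X := by
      rintro _ ⟨y, -, rfl⟩
      exact y.2
    have hc1 := (isClosed_inter_sigmaCube hΛ hX hK' hsub).preimage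
      (continuous_subtype_val (p := (· ∈ sigmaCube Λ ∪ X)))
    have hc1' : IsClosed (K ∩ S) := by
      convert hc1 using 1
      ext y
      simp [S]
    have hc2 : IsClosed (K ∩ Sᶜ) := by
      have : K ∩ Sᶜ = K ∩ {y | (y : Λ → unitInterval) ∈ X} := by
        ext y
        refine and_congr_right fun _ => ⟨fun h => y.2.resolve_left h, fun h =>
          not_mem_sigmaCube_of_mem_upperCube (hX h)⟩
      rw [this]
      exact hK.isClosed.inter (isClosed_setOf_coe_mem hX)
    have hcont : ContinuousOn (S.indicator fun _ => (1 : ℝ)) ((K ∩ S) ∪ (K ∩ Sᶜ)) := by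
      refine ContinuousOn.union_of_isClosed ?_ ?_ hc1' hc2
      · exact continuousOn_const.congr fun y hy => indicator_of_mem hy.2 _
      · exact continuousOn_const.congr fun y hy => indicator_of_notMem hy.2 _
    rwa [← inter_union_distrib_left, union_compl_self, inter_univ] at hcont
  have heq := hf.ext_on dense_setOf_coe_mem_sigmaCube continuous_const (g := fun _ => (1 : ℝ))
    fun y hy => indicator_of_mem hy _
  obtain ⟨x, hx⟩ := hne
  have hxS : (⟨x, Or.inr hx⟩ : ↥(sigmaCube Λ ∪ X)) ∉ S :=
    not_mem_sigmaCube_of_mem_upperCube (hX hx)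
  have := congrFun heq ⟨x, Or.inr hx⟩
  rw [indicator_of_notMem hxS] at this
  norm_num at this

end Cube

theorem topWeight_sigmaCube_union {Λ : Type u} (hΛ : ℵ₀ ≤ #Λ) (X : Set (Λ → unitInterval)) :
    topWeight ↥(sigmaCube Λ ∪ X) = #Λ := by
  classical
  refine le_antisymm (IsInducing.subtypeVal.topWeight_le.trans (topWeight_cube_le hΛ)) ?_
  -- The unit vectors form a discrete family of size `#Λ` in the Σ-product.
  refine mk_le_topWeight (fun i => ⟨Pi.single i 1, Or.inl ?_⟩) (fun i => {y | y.1 i ≠ 0})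
    (fun i => ?_) (fun i => ?_) fun i j h => ?_
  · refine (countable_singleton i).mono fun j hj => ?_
    by_contra hne
    exact hj (Pi.single_eq_of_ne hne _)
  · exact isOpen_ne_fun ((continuous_apply i).comp continuous_subtype_val) continuous_const
  · simp
  · by_contra hne
    exact h (Pi.single_eq_of_ne (Ne.symm hne) _)

/-! ### Transfer of compactness properties from `X` to `S ∪ T(X)` -/

section ClosedEmbedding

variable {X : Type u} {Λ : Type v} {T : X → Λ → unitInterval}

/-- The map of `X` into `S ∪ T(X)` given by `T`. -/
def toSigmaCubeUnion (T : X → Λ → unitInterval) (x : X) : ↥(sigmaCube Λ ∪ range T) :=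
  ⟨T x, Or.inr (mem_range_self x)⟩

theorem range_toSigmaCubeUnion (T : X → Λ → unitInterval) :
    range (toSigmaCubeUnion T) =
      {y : ↥(sigmaCube Λ ∪ range T) | (y : Λ → unitInterval) ∈ range T} := by
  ext y
  exact exists_congr fun x => Subtype.ext_iff

theorem exists_eq_toSigmaCubeUnion {y : ↥(sigmaCube Λ ∪ range T)}
    (hy : (y : Λ → unitInterval) ∉ sigmaCube Λ) : ∃ x, toSigmaCubeUnion T x = y := by
  obtain ⟨x, hx⟩ := y.2.resolve_left hy
  exact ⟨x, Subtype.ext hx⟩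

variable [TopologicalSpace X]

theorem isClosedEmbedding_toSigmaCubeUnion [Uncountable Λ] (hT : IsEmbedding T)
    (hTu : range T ⊆ upperCube Λ) : IsClosedEmbedding (toSigmaCubeUnion T) :=
  ⟨hT.codRestrict _ fun x => Or.inr (mem_range_self x), by
    rw [range_toSigmaCubeUnion]
    exact isClosed_setOf_coe_mem hTu⟩

theorem isOmegaBounded_sigmaCube_union (hT : IsClosedEmbedding (toSigmaCubeUnion T))
    (hX : IsOmegaBounded X) : IsOmegaBounded ↥(sigmaCube Λ ∪ range T) := by
  intro y
  let S : Set ↥(sigmaCube Λ ∪ range T) := {y | (y : Λ → unitInterval) ∈ sigmaCube Λ}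
  have h1 : IsCompact (closure (range y ∩ S)) :=
    isCompact_closure_of_countable_subset inter_subset_right
      ((countable_range y).mono inter_subset_left)
  have h2 : IsCompact (closure (range y ∩ Sᶜ)) := by
    -- `IsOmegaBounded` speaks of sequences, and only a nonempty countable set is the range of one.
    rcases (toSigmaCubeUnion T ⁻¹' range y).eq_empty_or_nonempty with h | h
    · have : range y ∩ Sᶜ = ∅ := by
        refine eq_empty_of_forall_notMem fun z hz => ?_
        obtain ⟨x, rfl⟩ := exists_eq_toSigmaCubeUnion hz.2
        exact (h ▸ hz.1 : x ∈ (∅ : Set X))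
      simp [this]
    · obtain ⟨x, hx⟩ := (((countable_range y).preimage hT.injective)).exists_eq_range h
      refine ((hX x).image hT.continuous).closure_of_subset fun z hz => ?_
      obtain ⟨x', rfl⟩ := exists_eq_toSigmaCubeUnion hz.2
      exact mem_image_of_mem _ (subset_closure (hx ▸ hz.1))
  have := h1.union h2
  rwa [← closure_union, ← inter_union_distrib_left, union_compl_self, inter_univ] at this

theorem seqCompactSpace_sigmaCube_union (hT : Continuous (toSigmaCubeUnion T))
    (hX : SeqCompactSpace X) : SeqCompactSpace ↥(sigmaCube Λ ∪ range T) := by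
  refine ⟨fun y _ => ?_⟩
  obtain ⟨φ, hφ, h | h⟩ := exists_strictMono_forall_mem_or
    {y : ↥(sigmaCube Λ ∪ range T) | (y : Λ → unitInterval) ∈ sigmaCube Λ} y
  · obtain ⟨a, -, ψ, hψ, ha⟩ := isSeqCompact_setOf_coe_mem_sigmaCube h
    exact ⟨a, trivial, φ ∘ ψ, hφ.comp hψ, ha⟩
  · choose x hx using fun n => exists_eq_toSigmaCubeUnion (h n)
    obtain ⟨a, ψ, hψ, ha⟩ := SeqCompactSpace.tendsto_subseq x
    refine ⟨toSigmaCubeUnion T a, trivial, φ ∘ ψ, hφ.comp hψ,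
      ((hT.tendsto a).comp ha).congr fun n => hx _⟩

theorem isTotallyCountablyCompact_sigmaCube_union (hT : Continuous (toSigmaCubeUnion T))
    (hX : IsTotallyCountablyCompact X) :
    IsTotallyCountablyCompact ↥(sigmaCube Λ ∪ range T) := by
  intro y
  obtain ⟨φ, hφ, h | h⟩ := exists_strictMono_forall_mem_or
    {y : ↥(sigmaCube Λ ∪ range T) | (y : Λ → unitInterval) ∈ sigmaCube Λ} y
  · exact ⟨φ, hφ, isCompact_closure_of_countable_subset (range_subset_iff.2 h) (countable_range _)⟩
  · choose x hx using fun n => exists_eq_toSigmaCubeUnion (h n)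
    obtain ⟨ψ, hψ, hc⟩ := hX x
    refine ⟨φ ∘ ψ, hφ.comp hψ, (hc.image hT).closure_of_subset ?_⟩
    rintro _ ⟨n, rfl⟩
    exact ⟨x (ψ n), subset_closure (mem_range_self n), hx _⟩

/-- Every nonempty open set meets the dense, sequentially compact `S`, so the points can be chosen
there whatever `X` is. -/
theorem isNearSequentiallyCompact_sigmaCube_union (X : Set (Λ → unitInterval)) :
    IsNearSequentiallyCompact ↥(sigmaCube Λ ∪ X) := by
  intro U hU
  choose x hxU hxS using fun n =>
    dense_setOf_coe_mem_sigmaCube.inter_open_nonempty (U n) (hU n).1 (hU n).2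
  obtain ⟨a, -, φ, hφ, ha⟩ := isSeqCompact_setOf_coe_mem_sigmaCube hxS
  exact ⟨x, hxU, a, φ, hφ, ha⟩

theorem countablyCompactSpace_sigmaCube_union (hT : Continuous (toSigmaCubeUnion T))
    (hX : CountablyCompactSpace X) : CountablyCompactSpace ↥(sigmaCube Λ ∪ range T) := by
  have h1 := (isSeqCompact_setOf_coe_mem_sigmaCube (X := range T)).isCountablyCompact
  have h2 := hX.isCountablyCompact_univ.image hT
  rw [← isCountablyCompact_univ_iff]
  have hu : Set.univ = {y : ↥(sigmaCube Λ ∪ range T) | (y : Λ → unitInterval) ∈ sigmaCube Λ} ∪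
      toSigmaCubeUnion T '' Set.univ := by
    rw [image_univ, range_toSigmaCubeUnion]
    exact (eq_univ_of_forall fun y => y.2).symm
  rw [hu]
  exact h1.union h2

end ClosedEmbedding

/-- The closed embedding theorem for nonempty spaces. -/
theorem exists_isClosedEmbedding_of_nonempty (X : Type u) [TopologicalSpace X] [T35Space X]
    [Nonempty X] :
    ∃ (Y : Type u) (_ : TopologicalSpace Y) (e : X → Y),
      T35Space Y ∧ IsClosedEmbedding e ∧
      IsPseudocompactSpace Y ∧ IsAscoliSpace Y ∧ ¬ IsKRSpace Y ∧
      topWeight Y = max (topWeight X) (ℵ_ 2) ∧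
      (IsOmegaBounded X → IsOmegaBounded Y) ∧
      (SeqCompactSpace X → SeqCompactSpace Y) ∧
      (IsTotallyCountablyCompact X → IsTotallyCountablyCompact Y) ∧
      (IsNearSequentiallyCompact X → IsNearSequentiallyCompact Y) ∧
      (CountablyCompactSpace X → CountablyCompactSpace Y) ∧
      (Nonempty X → ∃ (Λ : Type u) (T : X → Λ → unitInterval)
        (h : Y ≃ₜ ↥(sigmaCube Λ ∪ range T)),
          #Λ = max (topWeight X) (ℵ_ 2) ∧ IsEmbedding T ∧ range T ⊆ upperCube Λ ∧
          ∀ x, (h (e x) : Λ → unitInterval) = T x) := by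
  let Λ : Type u := (max (topWeight X) (ℵ_ 2)).out
  have hΛ : #Λ = max (topWeight X) (ℵ_ 2) := mk_out _
  have h2 : ℵ_ 2 ≤ #Λ := hΛ ▸ le_max_right _ _
  have h1 : ℵ_ 1 < #Λ := (aleph_lt_aleph.2 (by norm_num)).trans_le h2
  have h0 : ℵ₀ ≤ #Λ := (aleph0_le_aleph 2).trans h2
  have := uncountable_of_aleph_one_lt h1
  obtain ⟨T, hT, hTu⟩ := exists_isEmbedding_upperCube X h0 (hΛ ▸ le_max_left _ _)
  have he := isClosedEmbedding_toSigmaCubeUnion hT hTu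
  exact ⟨↥(sigmaCube Λ ∪ range T), inferInstance, toSigmaCubeUnion T, inferInstance, he,
    isPseudocompactSpace_of_dense dense_setOf_coe_mem_sigmaCube fun _ =>
      exists_isCompact_of_countable_subset,
    isAscoliSpace_of_dense dense_setOf_coe_mem_sigmaCube fun _ =>
      exists_isCompact_of_countable_subset,
    not_isKRSpace_sigmaCube_union h1 hTu (range_nonempty T),
    (topWeight_sigmaCube_union h0 _).trans hΛ,
    isOmegaBounded_sigmaCube_union he, seqCompactSpace_sigmaCube_union he.continuous,
    isTotallyCountablyCompact_sigmaCube_union he.continuous,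
    fun _ => isNearSequentiallyCompact_sigmaCube_union _,
    countablyCompactSpace_sigmaCube_union he.continuous,
    fun _ => ⟨Λ, T, Homeomorph.refl _, hΛ, hT, hTu, fun _ => rfl⟩⟩

theorem theorem3p13 :
    -- the subspace `S ∪ X` of `[0,1]^Λ`
    (∀ (Λ : Type v), ℵ_ 1 < #Λ → ∀ X : Set (Λ → unitInterval), X ⊆ upperCube Λ →
      (IsPseudocompactSpace ↥(sigmaCube Λ ∪ X) ∧ IsAscoliSpace ↥(sigmaCube Λ ∪ X)) ∧
      (∀ K : Set (Λ → unitInterval), K ⊆ sigmaCube Λ ∪ X → IsCompact K →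
        IsCompact (K ∩ sigmaCube Λ) ∧ IsCompact (K ∩ X)) ∧
      (X.Nonempty → ¬ IsKRSpace ↥(sigmaCube Λ ∪ X)) ∧
      IsClosed {y : ↥(sigmaCube Λ ∪ X) | (y : Λ → unitInterval) ∈ X}) ∧
    -- the closed embedding of an arbitrary Tychonoff space
    (∀ (X : Type u) [TopologicalSpace X] [T35Space X],
      ∃ (Y : Type u) (_ : TopologicalSpace Y) (e : X → Y),
        T35Space Y ∧ IsClosedEmbedding e ∧
        IsPseudocompactSpace Y ∧ IsAscoliSpace Y ∧ ¬ IsKRSpace Y ∧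
        topWeight Y = max (topWeight X) (ℵ_ 2) ∧
        (IsOmegaBounded X → IsOmegaBounded Y) ∧
        (SeqCompactSpace X → SeqCompactSpace Y) ∧
        (IsTotallyCountablyCompact X → IsTotallyCountablyCompact Y) ∧
        (IsNearSequentiallyCompact X → IsNearSequentiallyCompact Y) ∧
        (CountablyCompactSpace X → CountablyCompactSpace Y) ∧
        -- `Y` is `S ∪ T(X)` for an embedding `T` of `X` into `[1/2,1]^Λ`
        (Nonempty X → ∃ (Λ : Type u) (T : X → Λ → unitInterval)
          (h : Y ≃ₜ ↥(sigmaCube Λ ∪ range T)),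
            #Λ = max (topWeight X) (ℵ_ 2) ∧ IsEmbedding T ∧ range T ⊆ upperCube Λ ∧
            ∀ x, (h (e x) : Λ → unitInterval) = T x)) := by
  refine ⟨fun Λ hΛ X hX => ?_, fun X _ _ => ?_⟩
  · have := uncountable_of_aleph_one_lt hΛ
    refine ⟨⟨isPseudocompactSpace_of_dense dense_setOf_coe_mem_sigmaCube fun _ =>
        exists_isCompact_of_countable_subset,
      isAscoliSpace_of_dense dense_setOf_coe_mem_sigmaCube fun _ =>
        exists_isCompact_of_countable_subset⟩, fun K hKX hK => ⟨?_, ?_⟩,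
      not_isKRSpace_sigmaCube_union hΛ hX, isClosed_setOf_coe_mem hX⟩
    · exact hK.of_isClosed_subset (isClosed_inter_sigmaCube hΛ hX hK hKX) inter_subset_left
    · rw [inter_eq_inter_upperCube hX hKX]
      exact hK.inter_right isClosed_upperCube
  · rcases isEmpty_or_nonempty X with hX | hX
    -- The failure of the `k_ℝ` property needs a point outside `S`, so an empty `X` borrows the
    -- space built for a point: the required weight is again `ℵ_ 2`, and a point has all five
    -- compactness properties.
    · obtain ⟨Y, tY, -, h1, -, h3, h4, h5, h6, h7, h8, h9, h10, h11, -⟩ :=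
        exists_isClosedEmbedding_of_nonempty PUnit.{u + 1}
      have hw : ∀ (Z : Type u) [TopologicalSpace Z] [Subsingleton Z],
          max (topWeight Z) (ℵ_ 2) = ℵ_ 2 := fun Z _ _ =>
        max_eq_right ((topWeight_le_one Z).trans (one_le_aleph0.trans (aleph0_le_aleph 2)))
      exact ⟨Y, tY, isEmptyElim, h1, .of_continuous_injective_isClosedMap
          continuous_of_discreteTopology (Function.injective_of_subsingleton _) fun s _ => by
            rw [eq_empty_of_isEmpty s, image_empty]
            exact isClosed_empty,
        h3, h4, h5, h6.trans ((hw _).trans (hw X).symm),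
        fun _ => h7 fun _ => (Set.toFinite _).isCompact,
        fun _ => h8 ⟨fun x _ => ⟨PUnit.unit, trivial, id, strictMono_id,
          tendsto_const_nhds.congr fun _ => rfl⟩⟩,
        fun _ => h9 fun _ => ⟨id, strictMono_id, (Set.toFinite _).isCompact⟩,
        fun _ => h10 fun U hU => ⟨fun _ => PUnit.unit, fun n => (hU n).2.some_mem, PUnit.unit, id,
          strictMono_id, tendsto_const_nhds⟩,
        fun _ => h11 inferInstance, fun h => (not_isEmpty_iff.2 h hX).elim⟩
    · exact exists_isClosedEmbedding_of_nonempty X
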